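/- Work in cut-free first-order multiplicative linear logic without units: formulas are built from atoms $Pt_1\ldots t_n$ by $\otimes$, $⅋$, $\forall x$, $\exists x$; predicate symbols carry an arity-preserving, fixed-point-free involution $P\mapsto\overline P$; there are infinitely many variables; formulas are taken up to renaming of bound variables. A sequent $\Gamma$ is a finite disjoint union of formulas, viewed as a labelled forest (of parse trees, with edges directed towards the roots) in which, without loss of generality, bound variables are distinct from each other and from the free ones. *Unification nets.* A linking $\theta$ on $\Gamma$ is a set of disjoint pairs (links) of leaves with dual predicate symbols, covering all leaves of $\Gamma$. A unifier assigns to every non-vacuous existential variable a term over free and universal variables (these being treated as constants), so that the term sequences at the two ends of every link become equal; a most general unifier (mgu) is a unifier from which every other unifier is obtained by substituting for free variables not occurring in $\Gamma$. Given an mgu $\sigma$, the graph of $\theta$ is the forest $\Gamma$ together with an undirected edge for every link and a directed edge (leap) from $\exists x$ to $\forall y$ whenever $y$ occurs in $\sigma(x)$. A switching deletes all but one of the directed edges into each $⅋$ and each $\forall$ and undirects the remaining edges. $\theta$ is a *cut-free unification net* on $\Gamma$ if it has an mgu and all its switchings are trees. *Girard nets.* A cut-free Girard proof structure on $\Gamma$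 is a finite set of formula occurrences with links: axiom links with conclusions $Pt_1\ldots t_n$ and $\overline Pt_1\ldots t_n$ (identical terms); $\otimes$- and $⅋$-links with hypotheses $A,B$ and conclusion $A\otimes B$, respectively $A⅋ B$; $\exists$-links with hypothesis $B[x\mapsto t]$ and conclusion $\exists xB$; $\forall$-links with hypothesis $B[x\mapsto a]$ and conclusion $\forall xB$, where the eigenvariable $a$ is not free in $\forall xB$. Every occurrence is a conclusion of exactly one link and a hypothesis of at most one, those which are not hypotheses being in bijection with the formulas of $\Gamma$; distinct $\forall$-links have distinct eigenvariables, none of which is free in $\Gamma$. Its graph has an undirected edge for every axiom link, a directed edge from each hypothesis to the conclusion of its link, and a jump to the conclusion of each $\forall$-link from every occurrence in which its eigenvariable is free; switchings keep one directed edge into the conclusion of each $⅋$- and each $\forall$-link. It is a *Girard net* if all its switchings are trees. Its *translation* is the set of pairs of leaves of $\Gamma$ obtained by tracking its axiom links down onto the concluding formulas. **Theorem.** The translation from cut-free Girard nets to cut-free unification nets is surjective: for every cut-free unification net $\theta$ on a sequent $\Gamma$ there is a cut-free Girard net $G$ on $\Gamma$ whose translation is $\theta$. Moreover, for every mgu $\sigma$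 of $\theta$, such a $G$ can be chosen so that the witness of the $\exists$-link of $G$ corresponding to each non-vacuous existential variable $x$ of $\Gamma$ is $\sigma(x)$, with the universal variables of $\Gamma$ read as the eigenvariables of the corresponding $\forall$-links. -/

import Mathlib

universe u v w

namespace UNet

/-! ### Formulas and sequents of first-order multiplicative linear logic -/

/-- A duality on the predicate symbols of a language: an arity-preserving, fixed-point-free
involution. The function symbols (constants being the `0`-ary ones) and the predicate symbols are
those of the first-order language `L`. -/
structure Duality (L : FirstOrder.Language.{u, v}) where
  neg : ∀ {k : ℕ}, L.Relations k → L.Relations k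
  neg_neg : ∀ {k : ℕ} (P : L.Relations k), neg (neg P) = P
  neg_ne : ∀ {k : ℕ} (P : L.Relations k), neg P ≠ P

/-- Formulas with free variables among the names in `V` and `n` further variables `Fin n` waiting to
be bound; a quantifier binds the last one of them. Thus formulas are taken up to renaming of bound
variables, and `Fml L V 0` is the type of formulas proper. -/
inductive Fml (L : FirstOrder.Language.{u, v}) (V : Type w) : ℕ → Type (max u v w)
  | atom {n k : ℕ} (P : L.Relations k) (t : Fin k → L.Term (V ⊕ Fin n)) : Fml L V n
  | tensor {n : ℕ} (A B : Fml L V n) : Fml L V n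
  | par {n : ℕ} (A B : Fml L V n) : Fml L V n
  | all {n : ℕ} (B : Fml L V (n + 1)) : Fml L V n
  | ex {n : ℕ} (B : Fml L V (n + 1)) : Fml L V n

variable {L : FirstOrder.Language.{u, v}} {V : Type w}

/-- The variable `a` occurs in the term `t`. -/
def Occurs {α : Type*} (a : α) (t : L.Term α) : Prop :=
  open Classical in a ∈ t.varFinset

/-- The named variable `a` occurs free in a formula. -/
def Fml.Free (a : V) : {n : ℕ} → Fml L V n → Prop
  | _, .atom _ t => ∃ i, Occurs (Sum.inl a) (t i)
  | _, .tensor A B => A.Free a ∨ B.Free a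
  | _, .par A B => A.Free a ∨ B.Free a
  | _, .all B => B.Free a
  | _, .ex B => B.Free a

/-- Pass a substitution under a quantifier: the newly bound variable is left alone. -/
def liftSubst {W : Type*} {n m : ℕ} (f : V ⊕ Fin n → L.Term (W ⊕ Fin m)) :
    V ⊕ Fin (n + 1) → L.Term (W ⊕ Fin (m + 1)) :=
  Sum.elim (fun a => (f (Sum.inl a)).relabel (Sum.map id Fin.castSucc))
    (Fin.lastCases (FirstOrder.Language.Term.var (Sum.inr (Fin.last m)))
      (fun i => (f (Sum.inr i)).relabel (Sum.map id Fin.castSucc)))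

/-- Simultaneous capture-avoiding substitution. -/
def Fml.subst {W : Type*} : {n : ℕ} → Fml L V n → {m : ℕ} →
    (V ⊕ Fin n → L.Term (W ⊕ Fin m)) → Fml L W m
  | _, .atom P t, _, f => .atom P (fun i => (t i).subst f)
  | _, .tensor A B, _, f => .tensor (A.subst f) (B.subst f)
  | _, .par A B, _, f => .par (A.subst f) (B.subst f)
  | _, .all B, _, f => .all (B.subst (liftSubst f))
  | _, .ex B, _, f => .ex (B.subst (liftSubst f))

/-- `B.inst t` is the result `B[x ↦ t]` of substituting `t` for the variable `x` bound by the
quantifier in `∀x B` or `∃x B`. -/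
def Fml.inst (B : Fml L V 1) (t : L.Term V) : Fml L V 0 :=
  B.subst (Sum.elim (fun a => FirstOrder.Language.Term.var (Sum.inl a)) (fun _ => t.relabel Sum.inl))

/-- Rename the free variables of a formula. -/
def Fml.rename {W : Type*} (g : V → W) (A : Fml L V 0) : Fml L W 0 :=
  A.subst (Sum.elim (fun a => FirstOrder.Language.Term.var (Sum.inl (g a))) Fin.elim0)

/-- The ways to step up from a vertex of a parse tree: to the left or right argument of a
connective, or to the body of a quantifier. -/
inductive Dir
  | left
  | right
  | body

/-- Addresses of vertices in a sequent of `k` formulas: the formula, and the steps from its root to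
the vertex, the last step first. So `(i, p)` is the parent of `(i, d :: p)`. -/
abbrev Addr (k : ℕ) := Fin k × List Dir

/-- A sequent with `k` formulas. -/
abbrev Sequent (L : FirstOrder.Language.{u, v}) (V : Type w) (k : ℕ) := Fin k → Fml L V 0

/-- The immediate subformula of `A` in direction `d`, if there is one. If `A` sits at the vertex
with address `q` and is a quantified formula, then the variable that it binds is named `q`. -/
def Fml.child {k : ℕ} (q : Addr k) (d : Dir) (A : Fml L (V ⊕ Addr k) 0) :
    Option (Fml L (V ⊕ Addr k) 0) :=
  match A, d with
  | .tensor A _, .left => some A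
  | .tensor _ B, .right => some B
  | .par A _, .left => some A
  | .par _ B, .right => some B
  | .all B, .body => some (B.inst (FirstOrder.Language.Term.var (Sum.inr q)))
  | .ex B, .body => some (B.inst (FirstOrder.Language.Term.var (Sum.inr q)))
  | _, _ => none

section Sequents

variable {k : ℕ}

/-- The subformula of `Γ i` at the vertex with steps `p`, if there is such a vertex. -/
def nodeAux (Γ : Sequent L V k) (i : Fin k) : List Dir → Option (Fml L (V ⊕ Addr k) 0)
  | [] => some ((Γ i).rename Sum.inl)
  | d :: p => (nodeAux Γ i p).bind (Fml.child (i, p) d)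

/-- The subformula of the sequent `Γ` at an address, if this is the address of a vertex of the
parse forest of `Γ`. Its variables are the free variables `Sum.inl a` of `Γ`, and the bound
variables `Sum.inr q`, where `q` is the address of the binding quantifier: this is the clean
presentation of `Γ`, in which bound variables are distinct from each other and from free ones. -/
def node (Γ : Sequent L V k) (q : Addr k) : Option (Fml L (V ⊕ Addr k) 0) :=
  nodeAux Γ q.1 q.2

/-- The vertices of the parse forest of `Γ`. -/
def Vertex (Γ : Sequent L V k) := {q : Addr k // (node Γ q).isSome}

/-- The vertex `q` is a leaf. -/
def IsLeaf (Γ : Sequent L V k) (q : Addr k) : Prop :=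
  ∃ (m : ℕ) (P : L.Relations m) (t : Fin m → L.Term ((V ⊕ Addr k) ⊕ Fin 0)),
    node Γ q = some (.atom P t)

/-- `q` is a universal variable of `Γ`. -/
def IsUniversal (Γ : Sequent L V k) (q : Addr k) : Prop :=
  ∃ B, node Γ q = some (.all B)

/-- `q` is a non-vacuous existential variable of `Γ`: the quantifier at `q` is existential and it
binds at least one variable occurrence. -/
def IsExistential (Γ : Sequent L V k) (q : Addr k) : Prop :=
  ∃ B : Fml L (V ⊕ Addr k) 1, node Γ q = some (.ex B) ∧
    (B.inst (FirstOrder.Language.Term.var (Sum.inr q))).Free (Sum.inr q)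

/-! ### Linkings, unifiers and most general unifiers -/

/-- `θ` is a linking on `Γ`: a set of disjoint links that covers the leaves of `Γ`, where a link is a
pair of leaves with dual predicate symbols. -/
def IsLinking (D : Duality L) (Γ : Sequent L V k) (θ : Set (Sym2 (Vertex Γ))) : Prop :=
  (∀ l l' : Vertex Γ, s(l, l') ∈ θ →
    ∃ (m : ℕ) (P : L.Relations m) (t t' : Fin m → L.Term ((V ⊕ Addr k) ⊕ Fin 0)),
      node Γ l.1 = some (.atom P t) ∧ node Γ l'.1 = some (.atom (D.neg P) t')) ∧
  (∀ l : Vertex Γ, IsLeaf Γ l.1 → ∃! l' : Vertex Γ, s(l, l') ∈ θ)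

/-- An assignment of terms to the non-vacuous existential variables of `Γ`. -/
abbrev Assignment (Γ : Sequent L V k) := {q : Addr k // IsExistential Γ q} → L.Term (V ⊕ Addr k)

open Classical in
/-- The substitution of an assignment into a term of a leaf of `Γ`; free and universal variables
are treated as constants. -/
noncomputable def Assignment.apply {Γ : Sequent L V k} (σ : Assignment Γ)
    (t : L.Term ((V ⊕ Addr k) ⊕ Fin 0)) : L.Term (V ⊕ Addr k) :=
  t.subst (Sum.elim
    (Sum.elim (fun a => FirstOrder.Language.Term.var (Sum.inl a))
      (fun q => if h : IsExistential Γ q then σ ⟨q, h⟩ else FirstOrder.Language.Term.var (Sum.inr q)))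
    Fin.elim0)

/-- `σ` is a unifier for `θ`: its terms are built over free and universal variables, and it
equalizes the term sequences at the two ends of every link. -/
def IsUnifier (D : Duality L) (Γ : Sequent L V k) (θ : Set (Sym2 (Vertex Γ)))
    (σ : Assignment Γ) : Prop :=
  (∀ e q, Occurs (Sum.inr q) (σ e) → IsUniversal Γ q) ∧
  ∀ l l' : Vertex Γ, s(l, l') ∈ θ →
    ∀ (m : ℕ) (P : L.Relations m) (t t' : Fin m → L.Term ((V ⊕ Addr k) ⊕ Fin 0)),
      node Γ l.1 = some (.atom P t) → node Γ l'.1 = some (.atom (D.neg P) t') →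
      ∀ i, σ.apply (t i) = σ.apply (t' i)

/-- `σ` is a most general unifier for `θ`: every unifier is obtained from it by substituting for
free variables that do not occur in `Γ` (those of `Γ` and the universal ones being constants). -/
def IsMGU (D : Duality L) (Γ : Sequent L V k) (θ : Set (Sym2 (Vertex Γ)))
    (σ : Assignment Γ) : Prop :=
  IsUnifier D Γ θ σ ∧ ∀ τ : Assignment Γ, IsUnifier D Γ θ τ →
    ∃ ρ : V → L.Term (V ⊕ Addr k),
      (∀ a, (∃ i, (Γ i).Free a) → ρ a = FirstOrder.Language.Term.var (Sum.inl a)) ∧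
      ∀ e, τ e = (σ e).subst (Sum.elim ρ (fun q => FirstOrder.Language.Term.var (Sum.inr q)))

end Sequents

/-! ### Switchings -/

/-- A graph with undirected and directed edges and with a set of switched vertices. -/
structure SwitchGraph (N : Type*) where
  undirected : Set (Sym2 N)
  directed : N → N → Prop
  switched : Set N

namespace SwitchGraph

variable {N : Type*} (G : SwitchGraph N)

/-- A switching picks, for every switched vertex, one directed edge into it, given by its source
(the values of `f` elsewhere are irrelevant). -/
def IsSwitching (f : N → N) : Prop :=
  ∀ x ∈ G.switched, G.directed (f x) x

/-- The directed edges that remain: into a switched vertex only the one picked. -/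
def Kept (f : N → N) (x y : N) : Prop :=
  G.directed x y ∧ (y ∈ G.switched → x = f y)

/-- The graph of a switching, with the remaining edges undirected. -/
def switching (f : N → N) : SimpleGraph N :=
  SimpleGraph.fromRel (fun x y => s(x, y) ∈ G.undirected ∨ G.Kept f x y)

/-- The switching is a tree, as a multigraph: it has no loops (the case `x = y`) and no two
parallel edges, and its underlying simple graph is connected and acyclic. -/
def SwitchingIsTree (f : N → N) : Prop :=
  (∀ x, s(x, x) ∉ G.undirected) ∧
  (∀ x y, G.Kept f x y → ¬ G.Kept f y x) ∧
  (∀ x y, G.Kept f x y → s(x, y) ∉ G.undirected) ∧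
  (G.switching f).IsTree

/-- Every switching is a tree. -/
def Correct : Prop :=
  ∀ f : N → N, G.IsSwitching f → G.SwitchingIsTree f

end SwitchGraph

section Nets

variable {k : ℕ}

/-! ### Cut-free unification nets -/

/-- The graph of a linking `θ` with most general unifier `σ`: the parse forest with its edges
directed towards the roots, the links as undirected edges, and a leap from `∃x` to `∀y` whenever
`σ` assigns to `x` a term containing `y`. The switched vertices are the `⅋`s and the `∀`s. -/
def netGraph (Γ : Sequent L V k) (θ : Set (Sym2 (Vertex Γ))) (σ : Assignment Γ) :
    SwitchGraph (Vertex Γ) where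
  undirected := θ
  directed x y :=
    (∃ d, x.1 = (y.1.1, d :: y.1.2)) ∨
    (IsUniversal Γ y.1 ∧ ∃ h : IsExistential Γ x.1, Occurs (Sum.inr y.1) (σ ⟨x.1, h⟩))
  switched := {y | (∃ A B, node Γ y.1 = some (.par A B)) ∨ IsUniversal Γ y.1}

/-- `θ` is a cut-free unification net on `Γ`: a linking that has a most general unifier, with
respect to which all switchings are trees. (Most general unifiers are unique up to renaming of free
variables, so that leaps do not depend on the choice of one.) -/
def IsUnificationNet (D : Duality L) (Γ : Sequent L V k) (θ : Set (Sym2 (Vertex Γ))) : Prop :=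
  IsLinking D Γ θ ∧ ∃ σ : Assignment Γ, IsMGU D Γ θ σ ∧ (netGraph Γ θ σ).Correct

/-! ### Cut-free Girard nets -/

/-- The links of cut-free Girard nets, each stored at a formula occurrence that is a conclusion of
it. An axiom link has a second conclusion; the other links have hypotheses, and a `∀`-link has an
eigenvariable. -/
inductive GLink (V : Type w) (N : Type) : Type w
  | ax (other : N)
  | tensor (h h' : N)
  | par (h h' : N)
  | all (a : V) (h : N)
  | ex (h : N)

/-- The hypothesis of a link in a given position. -/
def GLink.hyp {N : Type} : GLink V N → Dir → Option N
  | .tensor h _, .left => some h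
  | .tensor _ h', .right => some h'
  | .par h _, .left => some h
  | .par _ h', .right => some h'
  | .all _ h, .body => some h
  | .ex h, .body => some h
  | _, _ => none

/-- The local condition on the link at the formula occurrence `x`. Axiom links join strictly dual
atoms (identical term sequences); an `∃`-link has hypothesis `B[x ↦ t]` and conclusion `∃x B`; a
`∀`-link has hypothesis `B[x ↦ a]` and conclusion `∀x B`, in which its eigenvariable `a` is not
free. -/
def LinkOK (D : Duality L) {N : Type} (label : N → Fml L V 0) (link : N → GLink V N) (x : N) :
    Prop :=
  match link x with
  | .ax y => link y = .ax x ∧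
      ∃ (m : ℕ) (P : L.Relations m) (t : Fin m → L.Term (V ⊕ Fin 0)),
        label x = .atom P t ∧ label y = .atom (D.neg P) t ∨
        label x = .atom (D.neg P) t ∧ label y = .atom P t
  | .tensor h h' => label x = .tensor (label h) (label h')
  | .par h h' => label x = .par (label h) (label h')
  | .all a h => ∃ B : Fml L V 1, label x = .all B ∧
      label h = B.inst (FirstOrder.Language.Term.var a) ∧ ¬ (label x).Free a
  | .ex h => ∃ (B : Fml L V 1) (t : L.Term V), label x = .ex B ∧ label h = B.inst t

/-- A cut-free Girard proof structure on `Γ`: a finite set `Occ` of formula occurrences, joined by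
links. Every occurrence is a conclusion of exactly one link and a hypothesis of at most one; those
which are not hypotheses are the concluding formulas, in bijection with the formulas of `Γ`.
Distinct `∀`-links have distinct eigenvariables, which are not free in the concluding formulas. -/
structure GirardStructure (D : Duality L) (Γ : Sequent L V k) where
  Occ : Type
  finite_occ : Finite Occ
  label : Occ → Fml L V 0
  link : Occ → GLink V Occ
  link_ok : ∀ x, LinkOK D label link x
  hyp_unique : ∀ x y d d' h, (link x).hyp d = some h → (link y).hyp d' = some h → x = y ∧ d = d'
  root : Fin k → Occ
  root_injective : Function.Injective root
  label_root : ∀ i, label (root i) = Γ i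
  mem_root_iff : ∀ x, (∃ i, root i = x) ↔ ∀ y d, (link y).hyp d ≠ some x
  eigen_unique : ∀ x y a h h', link x = .all a h → link y = .all a h' → x = y
  eigen_not_free : ∀ x a h, link x = .all a h → ∀ i, ¬ (Γ i).Free a

namespace GirardStructure

variable {D : Duality L} {Γ : Sequent L V k} (G : GirardStructure D Γ)

/-- The graph of a Girard proof structure: undirected edges for axiom links, edges from hypotheses
to conclusions of the other links, and a jump to the conclusion of a `∀`-link from every formula in
which its eigenvariable is free. The conclusions of `⅋`- and `∀`-links are switched. -/
def graph : SwitchGraph G.Occ where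
  undirected := {e | ∃ x y, e = s(x, y) ∧ G.link x = .ax y}
  directed x y :=
    (∃ d, (G.link y).hyp d = some x) ∨ (∃ a h, G.link y = .all a h ∧ (G.label x).Free a)
  switched := {y | (∃ h h', G.link y = .par h h') ∨ ∃ a h, G.link y = .all a h}

/-- `G` is a Girard net: every switching is a tree. -/
def IsNet : Prop := G.graph.Correct

/-- The formula occurrence `x` of `G` tracks down to the vertex of `Γ` with address `q`. -/
inductive Tracks : G.Occ → Addr k → Prop
  | root (i : Fin k) : Tracks (G.root i) (i, [])
  | hyp {x h : G.Occ} {i : Fin k} {p : List Dir} {d : Dir} :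
      Tracks x (i, p) → (G.link x).hyp d = some h → Tracks h (i, d :: p)

/-- The translation of `G`: its axiom links, tracked down onto the leaves of `Γ`. -/
def translation : Set (Sym2 (Vertex Γ)) :=
  {e | ∃ (x y : G.Occ) (l l' : Vertex Γ),
    e = s(l, l') ∧ G.link x = .ax y ∧ G.Tracks x l.1 ∧ G.Tracks y l'.1}

/-- The non-vacuous `∃`-links of `G` have the witnesses given by `σ`, in which every universal
variable of `Γ` is read as the eigenvariable `ε` of the corresponding `∀`-link of `G`. -/
def WitnessedBy (σ : Assignment Γ) : Prop :=
  ∃ ε : Addr k → V,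
    (∀ x a h q, G.link x = .all a h → G.Tracks x q → ε q = a) ∧
    ∀ x (e : {q : Addr k // IsExistential Γ q}), G.Tracks x e.1 →
      ∃ (B : Fml L V 1) (h : G.Occ), G.label x = .ex B ∧ G.link x = .ex h ∧
        G.label h = B.inst ((σ e).subst (fun z => FirstOrder.Language.Term.var (Sum.elim id ε z)))

end GirardStructure

end Nets

end UNet

/-! The occurrences of `G` are the vertices of `Γ`. Each is labelled with its subformula, in which
every existential variable is replaced by its value under `σ` and every universal one by a fresh
eigenvariable (`girardLabel`). Axiom links come from `θ` and the other links from the parse forest;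
axiom links join dual atoms with identical terms because `σ` unifies.

The graph of `G` differs from that of `θ` only in the edges into `∀`-vertices: jumps replace leaps.
By freshness, the eigenvariable of `∀y` is free at `x` only if `y` itself is free in the subformula
at `x`, so that `x` lies above `∀y`, or if some existential `z` with `y` in `σ(z)` is free there, so
that `x` lies above `∃z`, which leaps to `∀y`. Either way a jump is a directed path in the graph of
`θ` (`IsFresh.transGen_of_free`).

It remains to see that correctness survives when edges into switched vertices are replaced by
directed paths (`Correct.of_transGen`). This reduces to two composable edges `t → u → v` with `v`
switched (`Correct.insert`): re-routing the edge into `v` from `u` to `t` still joins the two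
components left by its removal. The same principle excludes directed cycles through switched
vertices, which yields the eigenvariable condition.

An arbitrary mgu may be used since all of them have the same leaps. -/

namespace UNet

open FirstOrder.Language (Term)

/-! ### Terms: occurrence and substitution -/

section Terms

variable {L : FirstOrder.Language.{u, v}} {α β γ : Type*}

theorem occurs_var {a b : α} : Occurs a (Term.var b : L.Term α) ↔ a = b := by
  simp [Occurs]

theorem occurs_func {n : ℕ} {a : α} {g : L.Functions n} {ts : Fin n → L.Term α} :
    Occurs a (Term.func g ts) ↔ ∃ i, Occurs a (ts i) := by
  simp [Occurs]

theorem occurs_subst {t : L.Term α} {f : α → L.Term β} {b : β} :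
    Occurs b (t.subst f) ↔ ∃ a, Occurs a t ∧ Occurs b (f a) := by
  induction t with
  | var a => simp [occurs_var, Term.subst]
  | func g ts ih =>
    simp only [Term.subst, occurs_func, ih]
    tauto

theorem Term.relabel_eq_subst (t : L.Term α) (g : α → β) :
    t.relabel g = t.subst (fun a => Term.var (g a)) := by
  induction t with
  | var a => rfl
  | func _ _ ih => simp [Term.subst, ih]

theorem Term.subst_subst (t : L.Term α) (f : α → L.Term β) (g : β → L.Term γ) :
    (t.subst f).subst g = t.subst (fun a => (f a).subst g) := by
  induction t with
  | var a => rfl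
  | func _ _ ih => simp [Term.subst, ih]

theorem Term.subst_var (t : L.Term α) : t.subst Term.var = t := by
  induction t with
  | var a => rfl
  | func _ _ ih => simp [Term.subst, ih]

theorem Term.subst_relabel (t : L.Term α) (f : α → L.Term β) (g : β → γ) :
    (t.subst f).relabel g = t.subst (fun a => (f a).relabel g) := by
  simp only [Term.relabel_eq_subst, Term.subst_subst]

theorem Term.relabel_subst (t : L.Term α) (g : α → β) (f : β → L.Term γ) :
    (t.relabel g).subst f = t.subst (fun a => f (g a)) := by
  rw [Term.relabel_eq_subst, Term.subst_subst]; rfl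

theorem occurs_relabel {t : L.Term α} {g : α → β} {b : β} :
    Occurs b (t.relabel g) ↔ ∃ a, Occurs a t ∧ b = g a := by
  simp only [Term.relabel_eq_subst, occurs_subst, occurs_var]

theorem finite_occurs (t : L.Term α) : {a | Occurs a t}.Finite := by
  classical
  refine (Finset.finite_toSet t.varFinset).subset fun a ha => ?_
  rw [SetLike.mem_coe]
  convert! ha

end Terms

/-! ### Formulas: substitution, free variables, height -/

section Formulas

variable {L : FirstOrder.Language.{u, v}} {V W X : Type*}

theorem liftSubst_subst {n m l : ℕ} (f : V ⊕ Fin n → L.Term (W ⊕ Fin m))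
    (g : W ⊕ Fin m → L.Term (X ⊕ Fin l)) (z : V ⊕ Fin (n + 1)) :
    (liftSubst f z).subst (liftSubst g) = liftSubst (fun y => (f y).subst g) z := by
  have key : ∀ y : W ⊕ Fin m, liftSubst g (Sum.map id Fin.castSucc y) =
      (g y).relabel (Sum.map id Fin.castSucc) := by
    rintro (a | i) <;> simp [liftSubst]
  rcases z with a | i
  · simp only [liftSubst, Sum.elim_inl, Term.relabel_subst, Term.subst_relabel]
    exact congrArg _ (funext key)
  · refine Fin.lastCases ?_ (fun i => ?_) i
    · simp [liftSubst, Term.subst]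
    · simp only [liftSubst, Sum.elim_inr, Fin.lastCases_castSucc, Term.relabel_subst,
        Term.subst_relabel]
      exact congrArg _ (funext key)

theorem liftSubst_var {n : ℕ} :
    liftSubst (Term.var : V ⊕ Fin n → L.Term (V ⊕ Fin n)) = Term.var := by
  funext z
  rcases z with a | i
  · simp [liftSubst]
  · refine Fin.lastCases ?_ (fun i => ?_) i <;> simp [liftSubst]

theorem Fml.subst_subst {n : ℕ} (A : Fml L V n) : ∀ {m l : ℕ} (f : V ⊕ Fin n → L.Term (W ⊕ Fin m))
    (g : W ⊕ Fin m → L.Term (X ⊕ Fin l)),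
    (A.subst f).subst g = A.subst (fun z => (f z).subst g) := by
  induction A with
  | atom P t => intros; simp [Fml.subst, Term.subst_subst]
  | tensor A B ihA ihB => intros; simp [Fml.subst, ihA, ihB]
  | par A B ihA ihB => intros; simp [Fml.subst, ihA, ihB]
  | all B ih => intros; simp [Fml.subst, ih, liftSubst_subst]
  | ex B ih => intros; simp [Fml.subst, ih, liftSubst_subst]

theorem Fml.subst_var {n : ℕ} (A : Fml L V n) : A.subst Term.var = A := by
  induction A with
  | atom P t => simp [Fml.subst, Term.subst_var]
  | tensor A B ihA ihB => simp [Fml.subst, ihA, ihB]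
  | par A B ihA ihB => simp [Fml.subst, ihA, ihB]
  | all B ih => simp [Fml.subst, liftSubst_var, ih]
  | ex B ih => simp [Fml.subst, liftSubst_var, ih]

/-- Makes the hypothesis of a quantifier link an instance of the substituted body. -/
theorem Fml.inst_subst (B : Fml L V 1) (s : L.Term V) (f : V ⊕ Fin 0 → L.Term (W ⊕ Fin 0))
    (s' : L.Term W) (h : (s.relabel Sum.inl).subst f = s'.relabel Sum.inl) :
    (B.inst s).subst f = (B.subst (liftSubst f)).inst s' := by
  rw [Fml.inst, Fml.inst, Fml.subst_subst, Fml.subst_subst]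
  congr 1
  funext z
  rcases z with a | i
  · simp only [Sum.elim_inl, Term.subst, liftSubst, Term.relabel_subst]
    conv_lhs => rw [← Term.subst_var (f (Sum.inl a))]
    congr 1
    funext y
    rcases y with b | j
    · rfl
    · exact j.elim0
  · obtain rfl : i = Fin.last 0 := Subsingleton.elim _ _
    rw [Sum.elim_inr, h, liftSubst, Sum.elim_inr, Fin.lastCases_last]
    rfl

/-- An upper bound suffices, since jumps only have to be dominated by paths; the second alternative
therefore does not ask that the index occur in `A`. -/
theorem Fml.free_of_free_subst {n : ℕ} {a : W} (A : Fml L V n) :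
    ∀ {m : ℕ} {f : V ⊕ Fin n → L.Term (W ⊕ Fin m)}, (A.subst f).Free a →
      (∃ b, A.Free b ∧ Occurs (Sum.inl a) (f (Sum.inl b))) ∨
        ∃ i, Occurs (Sum.inl a) (f (Sum.inr i)) := by
  -- Under a quantifier the only new value is the bound variable, which is not a named variable.
  have lift : ∀ {n m : ℕ} {f : V ⊕ Fin n → L.Term (W ⊕ Fin m)} (B : Fml L V (n + 1)),
      ((∃ b, B.Free b ∧ Occurs (Sum.inl a) (liftSubst f (Sum.inl b))) ∨
        ∃ i, Occurs (Sum.inl a) (liftSubst f (Sum.inr i))) →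
      (∃ b, B.Free b ∧ Occurs (Sum.inl a) (f (Sum.inl b))) ∨
        ∃ i, Occurs (Sum.inl a) (f (Sum.inr i)) := by
    rintro n m f B (⟨b, hb, h⟩ | ⟨i, h⟩)
    · simp only [liftSubst, Sum.elim_inl, occurs_relabel] at h
      obtain ⟨c | j, hc, e⟩ := h
      · obtain rfl : a = c := Sum.inl.inj e
        exact .inl ⟨b, hb, hc⟩
      · cases e
    · induction i using Fin.lastCases with
      | last => simp [liftSubst, occurs_var] at h
      | cast i =>
        simp only [liftSubst, Sum.elim_inr, Fin.lastCases_castSucc, occurs_relabel] at h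
        obtain ⟨c | j, hc, e⟩ := h
        · obtain rfl : a = c := Sum.inl.inj e
          exact .inr ⟨i, hc⟩
        · cases e
  induction A with
  | atom P t =>
    rintro m f ⟨i, hi⟩
    obtain ⟨b | j, hb, h⟩ := occurs_subst.1 hi
    · exact .inl ⟨b, ⟨i, hb⟩, h⟩
    · exact .inr ⟨j, h⟩
  | tensor A B ihA ihB =>
    rintro m f (h | h)
    · exact (ihA h).imp_left fun ⟨b, hb, h⟩ => ⟨b, .inl hb, h⟩
    · exact (ihB h).imp_left fun ⟨b, hb, h⟩ => ⟨b, .inr hb, h⟩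
  | par A B ihA ihB =>
    rintro m f (h | h)
    · exact (ihA h).imp_left fun ⟨b, hb, h⟩ => ⟨b, .inl hb, h⟩
    · exact (ihB h).imp_left fun ⟨b, hb, h⟩ => ⟨b, .inr hb, h⟩
  | all B ih => exact fun h => lift B (ih h)
  | ex B ih => exact fun h => lift B (ih h)

theorem Fml.free_of_free_rename {g : V → W} {A : Fml L V 0} {b : W} (h : (A.rename g).Free b) :
    ∃ a, A.Free a ∧ b = g a := by
  obtain ⟨a, ha, h⟩ | ⟨i, -⟩ := A.free_of_free_subst h
  · exact ⟨a, ha, by simpa [occurs_var] using h⟩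
  · exact i.elim0

theorem Fml.free_of_free_inst {B : Fml L V 1} {t : L.Term V} {a : V} (h : (B.inst t).Free a) :
    B.Free a ∨ Occurs a t := by
  obtain ⟨b, hb, h⟩ | ⟨i, h⟩ := B.free_of_free_subst h
  · obtain rfl : a = b := by simpa [occurs_var] using h
    exact .inl hb
  · simp only [Sum.elim_inr, occurs_relabel, Sum.inl.injEq] at h
    obtain ⟨c, hc, rfl⟩ := h
    exact .inr hc

theorem Fml.finite_free {n : ℕ} (A : Fml L V n) : {a | A.Free a}.Finite := by
  induction A with
  | atom P t =>
    simp only [Fml.Free, Set.ofPred_exists]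
    exact Set.finite_iUnion fun i =>
      (finite_occurs (t i)).preimage (Sum.inl_injective.injOn)
  | tensor A B ihA ihB => exact ihA.union ihB
  | par A B ihA ihB => exact ihA.union ihB
  | all B ih => exact ih
  | ex B ih => exact ih

/-- The height of the parse tree of a formula. -/
def Fml.height : {n : ℕ} → Fml L V n → ℕ
  | _, .atom _ _ => 0
  | _, .tensor A B => max A.height B.height + 1
  | _, .par A B => max A.height B.height + 1
  | _, .all B => B.height + 1
  | _, .ex B => B.height + 1

theorem Fml.height_subst {n : ℕ} (A : Fml L V n) :
    ∀ {m : ℕ} (f : V ⊕ Fin n → L.Term (W ⊕ Fin m)), (A.subst f).height = A.height := by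
  induction A <;> intros <;> simp_all [Fml.subst, Fml.height]

end Formulas

/-! ### Correct switching graphs: re-routing edges along directed paths -/

namespace SwitchGraph

variable {N : Type*}

/-- The undirected graph of all the edges in `U` and `K`. -/
def union (U : Set (Sym2 N)) (K : N → N → Prop) : SimpleGraph N :=
  SimpleGraph.fromRel (fun x y => s(x, y) ∈ U ∨ K x y)

/-- The edges in `U` and `K` form a tree as a multigraph. -/
def IsMultiTree (U : Set (Sym2 N)) (K : N → N → Prop) : Prop :=
  (∀ x, s(x, x) ∉ U) ∧ (∀ x y, K x y → ¬ K y x) ∧ (∀ x y, K x y → s(x, y) ∉ U) ∧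
    (union U K).IsTree

/-- The edges in `U` and `K` form a forest with two components, those of `a` and `b`. -/
def IsBiforest (U : Set (Sym2 N)) (K : N → N → Prop) (a b : N) : Prop :=
  (∀ x, s(x, x) ∉ U) ∧ (∀ x y, K x y → ¬ K y x) ∧ (∀ x y, K x y → s(x, y) ∉ U) ∧
    (union U K).IsAcyclic ∧ ¬ (union U K).Reachable a b ∧
    ∀ x, (union U K).Reachable x a ∨ (union U K).Reachable x b

theorem union_adj {U : Set (Sym2 N)} {K : N → N → Prop} {x y : N} :
    (union U K).Adj x y ↔ x ≠ y ∧ (s(x, y) ∈ U ∨ K x y ∨ K y x) := by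
  rw [union, SimpleGraph.fromRel_adj, Sym2.eq_swap (a := y)]
  tauto

theorem reachable_of_mem {U : Set (Sym2 N)} {K : N → N → Prop} {x y : N}
    (h : s(x, y) ∈ U ∨ K x y ∨ K y x) : (union U K).Reachable x y := by
  by_cases hxy : x = y
  · exact hxy ▸ .refl _
  · exact (union_adj.2 ⟨hxy, h⟩).reachable

theorem union_insert {U : Set (Sym2 N)} {K : N → N → Prop} (a b : N) :
    union U (fun x y => K x y ∨ x = a ∧ y = b) = union U K ⊔ SimpleGraph.edge a b := by
  ext x y
  simp only [SimpleGraph.sup_adj, union_adj, SimpleGraph.edge_adj]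
  tauto

/-- A tree minus an edge is a forest with two components. -/
theorem isMultiTree_insert_iff {U : Set (Sym2 N)} {K : N → N → Prop} {a b : N} (hab : ¬ K a b) :
    IsMultiTree U (fun x y => K x y ∨ x = a ∧ y = b) ↔ IsBiforest U K a b := by
  constructor
  · rintro ⟨h1, h2, h3, hT⟩
    have hne : a ≠ b := by
      rintro rfl
      exact h2 a a (.inr ⟨rfl, rfl⟩) (.inr ⟨rfl, rfl⟩)
    have hnadj : ¬ (union U K).Adj a b := by
      rw [union_adj]
      rintro ⟨-, h | h | h⟩
      · exact h3 a b (.inr ⟨rfl, rfl⟩) h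
      · exact hab h
      · exact h2 a b (.inr ⟨rfl, rfl⟩) (.inl h)
    rw [union_insert] at hT
    refine ⟨h1, fun x y h h' => h2 x y (.inl h) (.inl h'), fun x y h => h3 x y (.inl h),
      hT.isAcyclic.anti le_sup_left, ?_, fun x => ?_⟩
    · have hb := SimpleGraph.isAcyclic_iff_forall_adj_isBridge.1 hT.isAcyclic (v := a) (w := b)
        (by simp [SimpleGraph.edge_adj, hne])
      rw [SimpleGraph.isBridge_iff] at hb
      refine fun h => hb (h.mono fun x y hxy => ?_)
      rw [SimpleGraph.deleteEdges_adj]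
      refine ⟨.inl hxy, fun he => hnadj ?_⟩
      rw [Set.mem_singleton_iff] at he
      rw [← SimpleGraph.mem_edgeSet] at hxy ⊢
      exact he ▸ hxy
    · have hx := (SimpleGraph.reachable_iff_reflTransGen _ _).1 (hT.connected.preconnected x a)
      induction hx using Relation.ReflTransGen.head_induction_on with
      | refl => exact .inl (.refl _)
      | head h _ ih =>
        rw [SimpleGraph.sup_adj, SimpleGraph.edge_adj] at h
        obtain h | ⟨⟨rfl, -⟩ | ⟨rfl, -⟩, -⟩ := h
        · exact ih.imp h.reachable.trans h.reachable.trans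
        · exact .inl (.refl _)
        · exact .inr (.refl _)
  · rintro ⟨h1, h2, h3, hA, hR, hC⟩
    refine ⟨h1, ?_, ?_, ?_⟩
    · rintro x y (h | ⟨rfl, rfl⟩) (h' | ⟨rfl, h'⟩)
      · exact h2 x y h h'
      · subst h'
        exact hR (reachable_of_mem (.inr (.inr h)))
      · exact hR (reachable_of_mem (.inr (.inr h')))
      · exact hR (h' ▸ .refl _)
    · rintro x y (h | ⟨rfl, rfl⟩) h'
      · exact h3 x y h h'
      · exact hR (reachable_of_mem (.inl h'))
    · rw [union_insert]
      have hab' : (union U K ⊔ SimpleGraph.edge a b).Reachable b a := by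
        refine SimpleGraph.Adj.reachable ?_
        simp only [SimpleGraph.sup_adj, SimpleGraph.edge_adj]
        refine .inr ⟨by simp, ?_⟩
        rintro rfl
        exact hR (.refl _)
      have hra : ∀ x, (union U K ⊔ SimpleGraph.edge a b).Reachable x a := fun x =>
        (hC x).elim (fun h => h.mono le_sup_left) fun h => (h.mono le_sup_left).trans hab'
      have : Nonempty N := ⟨a⟩
      exact ⟨⟨fun x y => (hra x).trans (hra y).symm⟩, hA.sup_edge_of_not_reachable hR⟩

/-- The edges kept by the switching `f`, save those into `v`. -/
def KeptOff (G : SwitchGraph N) (f : N → N) (v x y : N) : Prop :=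
  G.Kept f x y ∧ y ≠ v

/-- Isolates the choice at `v`: the edges in `KeptOff` do not depend on it, so different choices are
compared as pairs of endpoints in one and the same graph. -/
theorem switchingIsTree_iff (G : SwitchGraph N) {f : N → N} {v : N} (hv : v ∈ G.switched)
    (hf : G.directed (f v) v) :
    G.SwitchingIsTree f ↔ IsBiforest G.undirected (G.KeptOff f v) (f v) v := by
  have : G.Kept f = fun x y => G.KeptOff f v x y ∨ x = f v ∧ y = v := by
    funext x y
    by_cases hy : y = v
    · subst hy
      simp only [Kept, KeptOff, ne_eq, not_true_eq_false, and_false, false_or, and_true, eq_iff_iff]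
      exact ⟨fun h => h.2 hv, by rintro rfl; exact ⟨hf, fun _ => rfl⟩⟩
    · simp [KeptOff, hy]
  rw [← isMultiTree_insert_iff (by simp [KeptOff]), ← this]
  rfl

theorem keptOff_congr {G : SwitchGraph N} {f g : N → N} {v : N} (h : ∀ y, y ≠ v → f y = g y) :
    G.KeptOff f v = G.KeptOff g v := by
  funext x y
  by_cases hy : y = v
  · simp [KeptOff, hy]
  · simp [KeptOff, Kept, h y hy]

/-- Replace the directed edges of a graph. -/
@[simps]
def withDirected (G : SwitchGraph N) (d : N → N → Prop) : SwitchGraph N where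
  undirected := G.undirected
  directed := d
  switched := G.switched

open Classical in
/-- A correct graph remains so if an edge into a switched vertex is drawn back along an edge into
its source. -/
theorem Correct.insert {G : SwitchGraph N} (hG : G.Correct) {t u v : N} (htu : G.directed t u)
    (huv : G.directed u v) (hv : v ∈ G.switched) :
    (G.withDirected fun x y => G.directed x y ∨ x = t ∧ y = v).Correct := by
  set G' := G.withDirected fun x y => G.directed x y ∨ x = t ∧ y = v
  intro f hf
  have hoff : ∀ x ∈ G.switched, x ≠ v → G.directed (f x) x := fun x hx hxv =>
    (hf x hx).resolve_right fun h => hxv h.2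
  -- If the edge picked at `v` is an old one, the switching is one of `G`.
  by_cases hfv : G.directed (f v) v
  · have hK : G'.Kept f = G.Kept f := by
      funext x y
      refine propext ⟨fun ⟨h, h'⟩ => ⟨h.elim id ?_, h'⟩, fun ⟨h, h'⟩ => ⟨.inl h, h'⟩⟩
      rintro ⟨-, rfl⟩
      exact h' hv ▸ hfv
    have hT := hG f fun x hx => if hxv : x = v then hxv ▸ hfv else hoff x hx hxv
    simp only [SwitchingIsTree, switching] at hT ⊢
    rw [hK]
    exact hT
  obtain hfv : f v = t := ((hf v hv).resolve_left hfv).1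
  have hK : G'.KeptOff f v = G.KeptOff f v := by
    funext x y
    simp only [KeptOff, Kept, G', withDirected_directed, withDirected_switched]
    grind
  rw [switchingIsTree_iff G' hv (.inr ⟨hfv, rfl⟩), hK, hfv]
  -- Picking `u → v` instead gives a switching of `G`; removing that edge leaves the components of
  -- `u` and `v`. It suffices that `t` lies in that of `u`.
  have hf₁ : G.IsSwitching (Function.update f v u) := fun x hx => by
    by_cases hxv : x = v
    · rw [hxv, Function.update_self]; exact huv
    · rw [Function.update_of_ne hxv]; exact hoff x hx hxv
  have hB := (switchingIsTree_iff G hv (by rw [Function.update_self]; exact huv)).1 (hG _ hf₁)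
  rw [Function.update_self,
    keptOff_congr (g := f) fun y hy => Function.update_of_ne hy _ _] at hB
  have htu' : (union G.undirected (G.KeptOff f v)).Reachable t u := by
    by_contra hn
    have hne : u ≠ v := by
      rintro rfl
      exact hB.2.2.2.2.1 (.refl _)
    -- Otherwise `t` lies in the component of `v`. The edge `t → u` is then not kept, so `u` is
    -- switched and can be made to pick `t`.
    have hu : u ∈ G.switched := by
      by_contra hu
      exact hn (reachable_of_mem (.inr (.inl ⟨⟨htu, fun h => (hu h).elim⟩, hne⟩)))
    have hf₂ : G.IsSwitching (Function.update (Function.update f v u) u t) := fun x hx => by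
      by_cases hxu : x = u
      · rw [hxu, Function.update_self]; exact htu
      · rw [Function.update_of_ne hxu]; exact hf₁ x hx
    have hf₂v : Function.update (Function.update f v u) u t v = u := by
      rw [Function.update_of_ne hne.symm, Function.update_self]
    have hB₂ := (switchingIsTree_iff G hv (by rw [hf₂v]; exact huv)).1 (hG _ hf₂)
    rw [hf₂v] at hB₂
    set f₂ := Function.update (Function.update f v u) u t
    have hf₂u : f₂ u = t := Function.update_self ..
    have hf₂o : ∀ x, x ≠ u → x ≠ v → f₂ x = f x := fun x hx hx' => by
      simp only [f₂]
      rw [Function.update_of_ne hx, Function.update_of_ne hx']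
    -- The path from `t` to `v` avoids `u`, which is in the other component, so it survives the
    -- change at `u`. With `t → u` it joins `u` to `v` without the edge `u → v`, a contradiction.
    refine hB₂.2.2.2.2.1 (.trans (.symm (reachable_of_mem (.inr (.inl
      ⟨⟨htu, fun _ => hf₂u.symm⟩, hne⟩)))) ?_)
    have htv := (hB.2.2.2.2.2 t).resolve_left hn
    have step : ∀ x y, x ≠ u → y ≠ u → (union G.undirected (G.KeptOff f v)).Adj x y →
        (union G.undirected (G.KeptOff f₂ v)).Adj x y := by
      intro x y hx hy h
      rw [union_adj] at h ⊢
      refine ⟨h.1, h.2.imp_right (Or.imp ?_ ?_)⟩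
      · rintro ⟨⟨h, h'⟩, h''⟩
        exact ⟨⟨h, fun hs => (h' hs).trans (hf₂o y hy h'').symm⟩, h''⟩
      · rintro ⟨⟨h, h'⟩, h''⟩
        exact ⟨⟨h, fun hs => (h' hs).trans (hf₂o x hx h'').symm⟩, h''⟩
    have hne' : ∀ {x}, (union G.undirected (G.KeptOff f v)).Reachable t x → x ≠ u := by
      rintro x hx rfl
      exact hn hx
    have hind : ∀ x, Relation.ReflTransGen (union G.undirected (G.KeptOff f v)).Adj t x →
        (union G.undirected (G.KeptOff f₂ v)).Reachable t x := fun x hx => by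
      induction hx with
      | refl => exact .refl _
      | tail h h' ih =>
        rw [← SimpleGraph.reachable_iff_reflTransGen] at h
        exact ih.trans (step _ _ (hne' h) (hne' (h.trans h'.reachable)) h').reachable
    exact hind v ((SimpleGraph.reachable_iff_reflTransGen _ _).1 htv)
  exact ⟨hB.1, hB.2.1, hB.2.2.1, hB.2.2.2.1, fun h => hB.2.2.2.2.1 (htu'.symm.trans h),
    fun x => (hB.2.2.2.2.2 x).imp_left fun h => h.trans htu'.symm⟩

/-- In a correct graph, edges into switched vertices may be drawn back along directed paths. -/
theorem Correct.of_transGen [Finite N] {G : SwitchGraph N} (hG : G.Correct) {d : N → N → Prop}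
    (hd : ∀ x y, y ∈ G.switched → d x y → Relation.TransGen G.directed x y)
    (hd' : ∀ x y, y ∉ G.switched → (d x y ↔ G.directed x y)) :
    (G.withDirected d).Correct := by
  -- A maximal correct extension is closed under the insertions above, hence contains every directed
  -- path of `G` into a switched vertex.
  obtain ⟨e, hle, ⟨he, heG⟩, hmax⟩ := Finite.exists_le_maximal (a := G.directed)
    (p := fun e : N → N → Prop => (G.withDirected e).Correct ∧
      ∀ x y, y ∉ G.switched → (e x y ↔ G.directed x y)) ⟨hG, fun _ _ _ => Iff.rfl⟩
  have hclosed : ∀ x y z, e x y → e y z → z ∈ G.switched → e x z := fun x y z hxy hyz hz => by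
    refine hmax (y := fun a b => e a b ∨ a = x ∧ b = z) ⟨he.insert hxy hyz hz, fun a b hb => ?_⟩
      (fun a b h => .inl h) x z (.inr ⟨rfl, rfl⟩)
    refine (or_iff_left ?_).trans (heG a b hb)
    rintro ⟨-, rfl⟩
    exact hb hz
  have htrans : ∀ x y, y ∈ G.switched → Relation.TransGen G.directed x y → e x y := by
    intro x y hy h
    induction h using Relation.TransGen.head_induction_on with
    | single h => exact hle _ _ h
    | head h _ ih => exact hclosed _ _ _ (hle _ _ h) ih hy
  -- Edges of `e` into switched vertices that are absent from `d` only add switchings: each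
  -- switching of `d` is one of `e`, with the same kept edges.
  have hK : ∀ f, (G.withDirected d).IsSwitching f → (G.withDirected e).IsSwitching f ∧
      (G.withDirected e).Kept f = (G.withDirected d).Kept f := by
    intro f hf
    refine ⟨fun x hx => htrans _ _ hx (hd _ _ hx (hf x hx)), ?_⟩
    funext x y
    simp only [Kept, withDirected_directed, withDirected_switched]
    by_cases hy : y ∈ G.switched
    · refine propext ⟨fun ⟨_, h⟩ => ⟨h hy ▸ hf y hy, h⟩, fun ⟨h, h'⟩ => ⟨?_, h'⟩⟩
      exact htrans _ _ hy (hd _ _ hy h)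
    · rw [hd' x y hy, heG x y hy]
  intro f hf
  obtain ⟨hf', hK⟩ := hK f hf
  have hT := he f hf'
  simp only [SwitchingIsTree, switching] at hT ⊢
  rw [← hK]
  exact hT

/-- In a correct graph, no directed path leads from a switched vertex to itself. -/
theorem Correct.not_transGen_self [Finite N] {G : SwitchGraph N} (hG : G.Correct)
    (hs : ∀ x ∈ G.switched, ∃ y, G.directed y x) {x : N} (hx : x ∈ G.switched) :
    ¬ Relation.TransGen G.directed x x := by
  classical
  intro h
  choose! f hf using hs
  -- The cycle would allow a loop at `x` to be added; a switching that picks it is not a tree.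
  have hc := hG.of_transGen (d := fun a b => G.directed a b ∨ a = x ∧ b = x)
    (by rintro a b - (h' | ⟨rfl, rfl⟩); exacts [.single h', h])
    (fun a b hb => or_iff_left (by rintro ⟨-, rfl⟩; exact hb hx))
  have hK : (G.withDirected fun a b => G.directed a b ∨ a = x ∧ b = x).Kept
      (Function.update f x x) x x := ⟨.inr ⟨rfl, rfl⟩, fun _ => by simp⟩
  refine (hc (Function.update f x x) fun y hy => ?_).2.1 x x hK hK
  by_cases hyx : y = x
  · rw [hyx, Function.update_self]; exact .inr ⟨rfl, rfl⟩
  · rw [Function.update_of_ne hyx]; exact .inl (hf y hy)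

end SwitchGraph
-- The parse forest: finiteness, binders, leaps
section Nodes

variable {L : FirstOrder.Language.{u, v}} {V : Type w} {k : ℕ}

instance : Finite Dir :=
  Finite.of_surjective (fun i : Fin 3 => ![Dir.left, Dir.right, Dir.body] i) fun d =>
    match d with
    | .left => ⟨0, rfl⟩
    | .right => ⟨1, rfl⟩
    | .body => ⟨2, rfl⟩

instance : Countable (Addr k) := inferInstanceAs (Countable (Fin k × List Dir))

theorem Fml.height_child {q : Addr k} {d : Dir} {A B : Fml L (V ⊕ Addr k) 0}
    (h : A.child q d = some B) : B.height < A.height := by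
  cases A <;> cases d <;> simp only [Fml.child, reduceCtorEq, Option.some.injEq] at h <;> subst h <;>
    simp [Fml.height, Fml.inst, Fml.height_subst]

/-- The form of `B` is recorded because its free occurrence of `q` is what makes an existential
variable non-vacuous. -/
theorem Fml.free_of_free_child {q : Addr k} {d : Dir} {A B : Fml L (V ⊕ Addr k) 0}
    (h : A.child q d = some B) {z : V ⊕ Addr k} (hz : B.Free z) :
    A.Free z ∨ z = Sum.inr q ∧ ∃ C : Fml L (V ⊕ Addr k) 1, (A = .all C ∨ A = .ex C) ∧
      B = C.inst (Term.var (Sum.inr q)) := by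
  cases A <;> cases d <;> simp only [Fml.child, reduceCtorEq, Option.some.injEq] at h <;> subst h
  · exact .inl (.inl hz)
  · exact .inl (.inr hz)
  · exact .inl (.inl hz)
  · exact .inl (.inr hz)
  · exact (Fml.free_of_free_inst hz).imp id fun h => ⟨occurs_var.1 h, _, .inl rfl, rfl⟩
  · exact (Fml.free_of_free_inst hz).imp id fun h => ⟨occurs_var.1 h, _, .inr rfl, rfl⟩

variable {Γ : Sequent L V k}

theorem node_cons (i : Fin k) (d : Dir) (p : List Dir) :
    node Γ (i, d :: p) = (node Γ (i, p)).bind (Fml.child (i, p) d) :=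
  rfl

theorem node_cons_eq_some {i : Fin k} {d : Dir} {p : List Dir} {B : Fml L (V ⊕ Addr k) 0} :
    node Γ (i, d :: p) = some B ↔ ∃ A, node Γ (i, p) = some A ∧ A.child (i, p) d = some B := by
  rw [node_cons, Option.bind_eq_some_iff]

theorem isSome_node_of_cons {i : Fin k} {d : Dir} {p : List Dir}
    (h : (node Γ (i, d :: p)).isSome) : (node Γ (i, p)).isSome := by
  obtain ⟨B, hB⟩ := Option.isSome_iff_exists.1 h
  obtain ⟨A, hA, -⟩ := node_cons_eq_some.1 hB
  exact Option.isSome_iff_exists.2 ⟨A, hA⟩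

theorem Vertex.exists_node (x : Vertex Γ) : ∃ A, node Γ x.1 = some A :=
  Option.isSome_iff_exists.1 x.2

/-- The vertex at an address at which there is a formula. -/
def Vertex.mk {q : Addr k} {A : Fml L (V ⊕ Addr k) 0} (h : node Γ q = some A) : Vertex Γ :=
  ⟨q, Option.isSome_iff_exists.2 ⟨A, h⟩⟩

/-- Each step up lowers the height, as instantiation preserves it; this bounds the addresses and
makes the forest finite. -/
theorem length_add_height_le {i : Fin k} {p : List Dir} :
    ∀ {A : Fml L (V ⊕ Addr k) 0}, node Γ (i, p) = some A → p.length + A.height ≤ (Γ i).height := by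
  induction p with
  | nil =>
    intro A h
    obtain rfl : (Γ i).rename Sum.inl = A := Option.some.inj h
    simp [Fml.rename, Fml.height_subst]
  | cons d p ih =>
    intro B h
    obtain ⟨A, hA, hB⟩ := node_cons_eq_some.1 h
    have := ih hA
    have := Fml.height_child hB
    simp only [List.length_cons]
    omega

theorem finite_addresses (Γ : Sequent L V k) : {q : Addr k | (node Γ q).isSome}.Finite := by
  obtain ⟨n, hn⟩ := (Set.finite_range fun i => (Γ i).height).bddAbove
  refine (Set.finite_univ.prod (List.finite_length_le Dir n)).subset ?_
  rintro ⟨i, p⟩ h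
  obtain ⟨A, hA⟩ := Option.isSome_iff_exists.1 h
  have h1 := length_add_height_le hA
  have h2 : (Γ i).height ≤ n := hn ⟨i, rfl⟩
  exact ⟨trivial, show p.length ≤ n by omega⟩

instance : Finite (Vertex Γ) := finite_addresses Γ

theorem IsExistential.isSome {q : Addr k} (h : IsExistential Γ q) : (node Γ q).isSome := by
  obtain ⟨B, hB, -⟩ := h
  simp [hB]

theorem IsUniversal.isSome {q : Addr k} (h : IsUniversal Γ q) : (node Γ q).isSome := by
  obtain ⟨B, hB⟩ := h
  simp [hB]

theorem IsExistential.not_isUniversal {q : Addr k} (h : IsExistential Γ q) :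
    ¬ IsUniversal Γ q := by
  obtain ⟨B, hB, -⟩ := h
  rintro ⟨C, hC⟩
  rw [hB] at hC
  cases hC

instance : Finite {q : Addr k // IsExistential Γ q} :=
  (finite_addresses Γ).subset fun _ h => IsExistential.isSome h

/-- The free variables of a subformula of `Γ` are free in `Γ`, or they are bound by a quantifier
below it. -/
theorem free_node {i : Fin k} {p : List Dir} :
    ∀ {A : Fml L (V ⊕ Addr k) 0}, node Γ (i, p) = some A →
      (∀ b, A.Free (Sum.inl b) → (Γ i).Free b) ∧
      ∀ r, A.Free (Sum.inr r) → (IsUniversal Γ r ∨ IsExistential Γ r) ∧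
        ∃ p' d, (i, p) = (r.1, p' ++ d :: r.2) := by
  induction p with
  | nil =>
    intro A h
    obtain rfl : (Γ i).rename Sum.inl = A := Option.some.inj h
    refine ⟨fun b hb => ?_, fun r hr => ?_⟩
    · obtain ⟨a, ha, h⟩ := Fml.free_of_free_rename hb
      exact Sum.inl.inj h ▸ ha
    · obtain ⟨a, -, h⟩ := Fml.free_of_free_rename hr
      cases h
  | cons d p ih =>
    intro B h
    obtain ⟨A, hA, hB⟩ := node_cons_eq_some.1 h
    refine ⟨fun b hb => ?_, fun r hr => ?_⟩
    · obtain h | ⟨h, -⟩ := Fml.free_of_free_child hB hb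
      · exact (ih hA).1 b h
      · cases h
    · obtain h | ⟨hr', C, hC, rfl⟩ := Fml.free_of_free_child hB hr
      · obtain ⟨h1, p', d', h2⟩ := (ih hA).2 r h
        obtain ⟨rfl, rfl⟩ := Prod.mk.inj h2
        exact ⟨h1, d :: p', d', rfl⟩
      · obtain rfl := Sum.inr.inj hr'
        refine ⟨?_, [], d, rfl⟩
        obtain rfl | rfl := hC
        · exact .inl ⟨C, hA⟩
        -- The free occurrence `hr` is itself the proof of non-vacuity.
        · exact .inr ⟨C, hA, hr⟩

variable {θ : Set (Sym2 (Vertex Γ))} {σ : Assignment Γ}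

theorem transGen_of_suffix {i : Fin k} {d : Dir} {p : List Dir} (y : Vertex Γ) (hy : y.1 = (i, p)) :
    ∀ (p' : List Dir) (x : Vertex Γ), x.1 = (i, p' ++ d :: p) →
      Relation.TransGen (netGraph Γ θ σ).directed x y := by
  intro p'
  induction p' with
  | nil =>
    intro x hx
    exact .single (.inl ⟨d, by rw [hx, hy]; rfl⟩)
  | cons d' p' ih =>
    intro x hx
    have hx' := x.2
    rw [hx] at hx'
    exact .head (.inl ⟨d', hx⟩) (ih ⟨_, isSome_node_of_cons hx'⟩ rfl)

/-- Guarantees that switchings exist, so that correctness is not vacuous. -/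
theorem exists_directed_of_switched {y : Vertex Γ} (hy : y ∈ (netGraph Γ θ σ).switched) :
    ∃ x, (netGraph Γ θ σ).directed x y := by
  obtain ⟨A, B, h⟩ | ⟨B, h⟩ := hy
  · exact ⟨Vertex.mk (node_cons_eq_some (d := .left).2 ⟨_, h, rfl⟩), .inl ⟨.left, rfl⟩⟩
  · exact ⟨Vertex.mk (node_cons_eq_some (d := .body).2 ⟨_, h, rfl⟩), .inl ⟨.body, rfl⟩⟩

variable {D : Duality L}

/-- Two most general unifiers have the same leaps. -/
theorem IsMGU.occurs_of_occurs {σ' : Assignment Γ} (h : IsMGU D Γ θ σ) (h' : IsMGU D Γ θ σ')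
    {e : {q : Addr k // IsExistential Γ q}} {q : Addr k} (hq : Occurs (Sum.inr q) (σ e)) :
    Occurs (Sum.inr q) (σ' e) := by
  obtain ⟨ρ, -, hρ⟩ := h.2 σ' h'.1
  rw [hρ e, occurs_subst]
  exact ⟨_, hq, occurs_var.2 rfl⟩

/-- Passing between mgus substitutes only for free variables, so universal variables in the values
are never lost. -/
theorem IsMGU.netGraph_eq {σ' : Assignment Γ} (h : IsMGU D Γ θ σ) (h' : IsMGU D Γ θ σ') :
    netGraph Γ θ σ = netGraph Γ θ σ' := by
  have : ∀ e q, Occurs (Sum.inr q) (σ e) ↔ Occurs (Sum.inr q) (σ' e) := fun e q =>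
    ⟨h.occurs_of_occurs h', h'.occurs_of_occurs h⟩
  simp only [netGraph, this]

end Nodes

/-! ### The Girard net of a unification net -/

section Construction

variable {L : FirstOrder.Language.{u, v}} {V : Type w} {k : ℕ} {Γ : Sequent L V k}

open Classical in
/-- The reading of the variables of `Γ` in the Girard net with eigenvariables `ε` and witnesses
given by `σ`. -/
noncomputable def Assignment.read (σ : Assignment Γ) (ε : Addr k → V) : V ⊕ Addr k → L.Term V
  | .inl a => Term.var a
  | .inr q => if h : IsExistential Γ q then (σ ⟨q, h⟩).subst (fun z => Term.var (Sum.elim id ε z))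
      else Term.var (ε q)

theorem Assignment.read_of_isExistential (σ : Assignment Γ) (ε : Addr k → V)
    (e : {q : Addr k // IsExistential Γ q}) :
    σ.read ε (.inr e.1) = (σ e).subst (fun z => Term.var (Sum.elim id ε z)) := by
  simp [Assignment.read, e.2]

theorem Assignment.read_of_isUniversal (σ : Assignment Γ) (ε : Addr k → V) {q : Addr k}
    (h : IsUniversal Γ q) : σ.read ε (.inr q) = Term.var (ε q) := by
  rw [Assignment.read, dif_neg fun h' => h'.not_isUniversal h]

/-- `Assignment.read`, as a substitution into formulas. -/
noncomputable def Assignment.readSubst (σ : Assignment Γ) (ε : Addr k → V) :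
    (V ⊕ Addr k) ⊕ Fin 0 → L.Term (V ⊕ Fin 0) :=
  Sum.elim (fun z => (σ.read ε z).relabel Sum.inl) Fin.elim0

/-- The reading factors through `σ.apply`, so what `σ` unifies becomes identical in the net. -/
theorem Assignment.subst_readSubst_congr (σ : Assignment Γ) (ε : Addr k → V)
    {t t' : L.Term ((V ⊕ Addr k) ⊕ Fin 0)} (h : σ.apply t = σ.apply t') :
    t.subst (σ.readSubst ε) = t'.subst (σ.readSubst ε) := by
  have key : ∀ t : L.Term ((V ⊕ Addr k) ⊕ Fin 0), t.subst (σ.readSubst ε) =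
      (σ.apply t).subst fun z => Term.var (Sum.inl (Sum.elim id ε z)) := by
    intro t
    rw [Assignment.apply, Term.subst_subst]
    congr 1
    funext z
    obtain (a | q) | i := z
    · rfl
    · by_cases hq : IsExistential Γ q
      · simp [Assignment.readSubst, Assignment.read, hq, Term.subst_relabel]
      · simp [Assignment.readSubst, Assignment.read, hq, Term.subst]
    · exact i.elim0
  rw [key, key, h]

/-- The formula occurrence at a vertex of `Γ` in the Girard net. -/
noncomputable def girardLabel (σ : Assignment Γ) (ε : Addr k → V) (x : Vertex Γ) : Fml L V 0 :=
  ((node Γ x.1).get x.2).subst (σ.readSubst ε)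

theorem girardLabel_eq (σ : Assignment Γ) (ε : Addr k → V) {x : Vertex Γ}
    {A : Fml L (V ⊕ Addr k) 0} (h : node Γ x.1 = some A) :
    girardLabel σ ε x = A.subst (σ.readSubst ε) := by
  simp [girardLabel, h]

/-- This covers vacuous `∃` too: their witness is the default value `ε` of `Assignment.read`, which
is harmless. -/
theorem girardLabel_body (σ : Assignment Γ) (ε : Addr k → V) {x h : Vertex Γ}
    {B : Fml L (V ⊕ Addr k) 1} (hx : node Γ x.1 = some (.all B) ∨ node Γ x.1 = some (.ex B))
    (hh : h.1 = (x.1.1, .body :: x.1.2)) :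
    girardLabel σ ε h = (B.subst (liftSubst (σ.readSubst ε))).inst (σ.read ε (.inr x.1)) := by
  have hB : node Γ h.1 = some (B.inst (Term.var (Sum.inr x.1))) := by
    rw [hh, node_cons_eq_some]
    obtain hx | hx := hx <;> exact ⟨_, hx, rfl⟩
  rw [girardLabel_eq σ ε hB]
  exact Fml.inst_subst _ _ _ _ rfl

/-- The link of the Girard net at a vertex of `Γ`. -/
inductive IsGirardLink (θ : Set (Sym2 (Vertex Γ))) (ε : Addr k → V) (x : Vertex Γ) :
    GLink V (Vertex Γ) → Prop
  | ax {y : Vertex Γ} : IsLeaf Γ x.1 → s(x, y) ∈ θ → IsGirardLink θ ε x (.ax y)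
  | tensor {A B : Fml L (V ⊕ Addr k) 0} {h h' : Vertex Γ} : node Γ x.1 = some (.tensor A B) →
      h.1 = (x.1.1, .left :: x.1.2) → h'.1 = (x.1.1, .right :: x.1.2) →
      IsGirardLink θ ε x (.tensor h h')
  | par {A B : Fml L (V ⊕ Addr k) 0} {h h' : Vertex Γ} : node Γ x.1 = some (.par A B) →
      h.1 = (x.1.1, .left :: x.1.2) → h'.1 = (x.1.1, .right :: x.1.2) →
      IsGirardLink θ ε x (.par h h')
  | all {B : Fml L (V ⊕ Addr k) 1} {h : Vertex Γ} : node Γ x.1 = some (.all B) →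
      h.1 = (x.1.1, .body :: x.1.2) → IsGirardLink θ ε x (.all (ε x.1) h)
  | ex {B : Fml L (V ⊕ Addr k) 1} {h : Vertex Γ} : node Γ x.1 = some (.ex B) →
      h.1 = (x.1.1, .body :: x.1.2) → IsGirardLink θ ε x (.ex h)

variable {D : Duality L} {θ : Set (Sym2 (Vertex Γ))}

theorem IsLinking.exists_isGirardLink (hθ : IsLinking D Γ θ) (ε : Addr k → V) (x : Vertex Γ) :
    ∃ l, IsGirardLink θ ε x l := by
  obtain ⟨A, hA⟩ := x.exists_node
  have child : ∀ {d B}, A.child x.1 d = some B → ∃ h : Vertex Γ, h.1 = (x.1.1, d :: x.1.2) :=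
    fun hB => ⟨Vertex.mk (node_cons_eq_some.2 ⟨A, hA, hB⟩), rfl⟩
  cases A with
  | atom P t =>
    have hx : IsLeaf Γ x.1 := ⟨_, P, t, hA⟩
    obtain ⟨y, hy, -⟩ := hθ.2 x hx
    exact ⟨_, .ax hx hy⟩
  | tensor A B =>
    obtain ⟨h, hh⟩ := child (d := .left) rfl
    obtain ⟨h', hh'⟩ := child (d := .right) rfl
    exact ⟨_, .tensor hA hh hh'⟩
  | par A B =>
    obtain ⟨h, hh⟩ := child (d := .left) rfl
    obtain ⟨h', hh'⟩ := child (d := .right) rfl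
    exact ⟨_, .par hA hh hh'⟩
  | all B =>
    obtain ⟨h, hh⟩ := child (d := .body) rfl
    exact ⟨_, .all hA hh⟩
  | ex B =>
    obtain ⟨h, hh⟩ := child (d := .body) rfl
    exact ⟨_, .ex hA hh⟩

theorem IsLinking.isLeaf (hθ : IsLinking D Γ θ) {x y : Vertex Γ} (h : s(x, y) ∈ θ) :
    IsLeaf Γ x.1 := by
  obtain ⟨m, P, t, -, h, -⟩ := hθ.1 x y h
  exact ⟨m, P, t, h⟩

variable {ε : Addr k → V}

theorem IsGirardLink.eq_of_hyp {x h : Vertex Γ} {l : GLink V (Vertex Γ)} {d : Dir}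
    (hl : IsGirardLink θ ε x l) (hd : l.hyp d = some h) : h.1 = (x.1.1, d :: x.1.2) := by
  cases hl <;> cases d <;> simp only [GLink.hyp, reduceCtorEq, Option.some.injEq] at hd <;>
    subst hd <;> assumption

/-- With `eq_of_hyp`: the hypotheses of the link at a vertex are exactly its children in the forest.
-/
theorem IsGirardLink.hyp_eq {x h : Vertex Γ} {l : GLink V (Vertex Γ)} {d : Dir}
    (hl : IsGirardLink θ ε x l) (hh : h.1 = (x.1.1, d :: x.1.2)) : l.hyp d = some h := by
  obtain ⟨B, hB⟩ := h.exists_node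
  rw [hh] at hB
  obtain ⟨A, hA, hB⟩ := node_cons_eq_some.1 hB
  cases hl with
  | ax hx =>
    obtain ⟨m, P, t, hx⟩ := hx
    obtain rfl := Option.some.inj (hA.symm.trans hx)
    cases hB
  | tensor hx h1 h2 =>
    obtain rfl := Option.some.inj (hA.symm.trans hx)
    cases d
    · exact congrArg some (Subtype.ext (h1.trans hh.symm))
    · exact congrArg some (Subtype.ext (h2.trans hh.symm))
    · cases hB
  | par hx h1 h2 =>
    obtain rfl := Option.some.inj (hA.symm.trans hx)
    cases d
    · exact congrArg some (Subtype.ext (h1.trans hh.symm))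
    · exact congrArg some (Subtype.ext (h2.trans hh.symm))
    · cases hB
  | all hx h1 =>
    obtain rfl := Option.some.inj (hA.symm.trans hx)
    cases d
    · cases hB
    · cases hB
    · exact congrArg some (Subtype.ext (h1.trans hh.symm))
  | ex hx h1 =>
    obtain rfl := Option.some.inj (hA.symm.trans hx)
    cases d
    · cases hB
    · cases hB
    · exact congrArg some (Subtype.ext (h1.trans hh.symm))

variable {σ : Assignment Γ}

/-- Eigenvariables which are distinct, not free in `Γ`, and new to `σ`. -/
structure IsFresh (σ : Assignment Γ) (ε : Addr k → V) : Prop where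
  injective : Function.Injective ε
  not_free : ∀ q i, ¬ (Γ i).Free (ε q)
  not_occurs : ∀ q e, ¬ Occurs (Sum.inl (ε q)) (σ e)

theorem exists_isFresh [Infinite V] (σ : Assignment Γ) : ∃ ε, IsFresh σ ε := by
  let S : Set V := (⋃ i, {a | (Γ i).Free a}) ∪ ⋃ e, {a | Occurs (Sum.inl a) (σ e)}
  have hS : S.Finite := (Set.finite_iUnion fun i => (Γ i).finite_free).union
    (Set.finite_iUnion fun e => (finite_occurs (σ e)).preimage Sum.inl_injective.injOn)
  have : Infinite (Sᶜ : Set V) := hS.infinite_compl.to_subtype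
  obtain ⟨g, hg⟩ := Countable.exists_injective_nat (Addr k)
  refine ⟨fun q => (Infinite.natEmbedding (Sᶜ : Set V) (g q)).1, ?_, fun q i h => ?_,
    fun q e h => ?_⟩
  · exact Subtype.val_injective.comp ((Infinite.natEmbedding _).injective.comp hg)
  · exact (Infinite.natEmbedding (Sᶜ : Set V) (g q)).2 (.inl (Set.mem_iUnion.2 ⟨i, h⟩))
  · exact (Infinite.natEmbedding (Sᶜ : Set V) (g q)).2 (.inr (Set.mem_iUnion.2 ⟨e, h⟩))

/-- Jumps of the Girard net are directed paths in the graph of the unification net. -/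
theorem IsFresh.transGen_of_free (hε : IsFresh σ ε) {x y : Vertex Γ} (hy : IsUniversal Γ y.1)
    (h : (girardLabel σ ε x).Free (ε y.1)) : Relation.TransGen (netGraph Γ θ σ).directed x y := by
  obtain ⟨A, hA⟩ := x.exists_node
  rw [girardLabel_eq σ ε hA] at h
  obtain ⟨z, hz, h⟩ | ⟨i, -⟩ := A.free_of_free_subst h
  swap
  · exact i.elim0
  simp only [Assignment.readSubst, Sum.elim_inl, occurs_relabel, Sum.inl.injEq, exists_eq_right'] at h
  obtain ⟨hfree, hbound⟩ := free_node (i := x.1.1) (p := x.1.2) hA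
  obtain b | r := z
  · obtain rfl := occurs_var.1 h
    -- A free variable of `Γ` is no eigenvariable.
    exact (hε.not_free _ _ (hfree _ hz)).elim
  obtain ⟨hr, p', d, hp⟩ := hbound r hz
  obtain hr | hr := hr
  · rw [σ.read_of_isUniversal ε hr, occurs_var] at h
    obtain rfl := hε.injective h
    exact transGen_of_suffix y rfl p' x hp
  · rw [σ.read_of_isExistential ε ⟨r, hr⟩, occurs_subst] at h
    obtain ⟨c | q, hc, h⟩ := h
    · obtain rfl := occurs_var.1 h
      exact (hε.not_occurs _ _ hc).elim
    · obtain rfl := hε.injective (occurs_var.1 h)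
      -- Down the tree to the existential binder `r`, then one leap to `y`.
      exact .tail (transGen_of_suffix ⟨r, hr.isSome⟩ rfl p' x hp) (.inr ⟨hy, hr, hc⟩)

theorem IsGirardLink.linkOK (hθ : IsLinking D Γ θ) (hσ : IsUnifier D Γ θ σ)
    (hG : (netGraph Γ θ σ).Correct) (hε : IsFresh σ ε) {link : Vertex Γ → GLink V (Vertex Γ)}
    (hlink : ∀ x, IsGirardLink θ ε x (link x)) (x : Vertex Γ) :
    LinkOK D (girardLabel σ ε) link x := by
  have hx := hlink x
  rw [LinkOK]
  generalize link x = l at hx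
  cases hx with
  | @ax y hx hxy =>
    refine ⟨?_, ?_⟩
    · have hyx : s(y, x) ∈ θ := Sym2.eq_swap ▸ hxy
      have hy := hθ.isLeaf hyx
      have hly := hlink y
      generalize link y = l at hly
      cases hly with
      | ax _ h => rw [(hθ.2 y hy).unique h hyx]
      | tensor h => obtain ⟨_, _, _, hy⟩ := hy; rw [hy] at h; cases h
      | par h => obtain ⟨_, _, _, hy⟩ := hy; rw [hy] at h; cases h
      | all h => obtain ⟨_, _, _, hy⟩ := hy; rw [hy] at h; cases h
      | ex h => obtain ⟨_, _, _, hy⟩ := hy; rw [hy] at h; cases h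
    · obtain ⟨m, P, t, t', h, h'⟩ := hθ.1 x y hxy
      refine ⟨m, P, fun i => (t i).subst (σ.readSubst ε), .inl ⟨girardLabel_eq σ ε h, ?_⟩⟩
      rw [girardLabel_eq σ ε h', Fml.subst]
      congr 1
      funext i
      exact (σ.subst_readSubst_congr ε (hσ.2 x y hxy m P t t' h h' i)).symm
  | tensor h h1 h2 =>
    have e1 := girardLabel_eq σ ε (h1 ▸ node_cons_eq_some.2 ⟨_, h, rfl⟩)
    have e2 := girardLabel_eq σ ε (h2 ▸ node_cons_eq_some.2 ⟨_, h, rfl⟩)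
    simp only [girardLabel_eq σ ε h, e1, e2, Fml.subst]
  | par h h1 h2 =>
    have e1 := girardLabel_eq σ ε (h1 ▸ node_cons_eq_some.2 ⟨_, h, rfl⟩)
    have e2 := girardLabel_eq σ ε (h2 ▸ node_cons_eq_some.2 ⟨_, h, rfl⟩)
    simp only [girardLabel_eq σ ε h, e1, e2, Fml.subst]
  | all h h1 =>
    refine ⟨_, girardLabel_eq σ ε h, ?_, fun hf => ?_⟩
    · rw [girardLabel_body σ ε (.inl h) h1, σ.read_of_isUniversal ε ⟨_, h⟩]
    -- An eigenvariable free in its own conclusion would give a directed path from this `∀` to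
    -- itself.
    · exact hG.not_transGen_self (fun _ => exists_directed_of_switched) (.inr ⟨_, h⟩)
        (hε.transGen_of_free ⟨_, h⟩ hf)
  | ex h h1 => exact ⟨_, _, girardLabel_eq σ ε h, girardLabel_body σ ε (.inr h) h1⟩

theorem IsGirardLink.mem_of_eq_ax {x y : Vertex Γ} {l : GLink V (Vertex Γ)}
    (hl : IsGirardLink θ ε x l) (h : l = .ax y) : s(x, y) ∈ θ := by
  subst h
  cases hl
  assumption

theorem IsGirardLink.of_eq_all {x h : Vertex Γ} {a : V} {l : GLink V (Vertex Γ)}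
    (hl : IsGirardLink θ ε x l) (h : l = .all a h) : a = ε x.1 ∧ IsUniversal Γ x.1 := by
  subst h
  cases hl with
  | all h => exact ⟨rfl, _, h⟩

theorem IsGirardLink.of_eq_par {x h h' : Vertex Γ} {l : GLink V (Vertex Γ)}
    (hl : IsGirardLink θ ε x l) (h : l = .par h h') : ∃ A B, node Γ x.1 = some (.par A B) := by
  subst h
  cases hl with
  | par h => exact ⟨_, _, h⟩

theorem IsGirardLink.exists_eq_ax {x : Vertex Γ} {l : GLink V (Vertex Γ)}
    (hl : IsGirardLink θ ε x l) (hx : IsLeaf Γ x.1) : ∃ y, l = .ax y := by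
  obtain ⟨m, P, t, hx⟩ := hx
  cases hl with
  | ax => exact ⟨_, rfl⟩
  | tensor h => rw [hx] at h; cases h
  | par h => rw [hx] at h; cases h
  | all h => rw [hx] at h; cases h
  | ex h => rw [hx] at h; cases h

theorem IsGirardLink.exists_eq_par {x : Vertex Γ} {l : GLink V (Vertex Γ)}
    (hl : IsGirardLink θ ε x l) {A B : Fml L (V ⊕ Addr k) 0} (hx : node Γ x.1 = some (.par A B)) :
    ∃ h h', l = .par h h' := by
  cases hl with
  | ax h => obtain ⟨_, _, _, h⟩ := h; rw [hx] at h; cases h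
  | tensor h => rw [hx] at h; cases h
  | par h => exact ⟨_, _, rfl⟩
  | all h => rw [hx] at h; cases h
  | ex h => rw [hx] at h; cases h

theorem IsGirardLink.exists_eq_all {x : Vertex Γ} {l : GLink V (Vertex Γ)}
    (hl : IsGirardLink θ ε x l) (hx : IsUniversal Γ x.1) : ∃ h, l = .all (ε x.1) h := by
  obtain ⟨B, hx⟩ := hx
  cases hl with
  | ax h => obtain ⟨_, _, _, h⟩ := h; rw [hx] at h; cases h
  | tensor h => rw [hx] at h; cases h
  | par h => rw [hx] at h; cases h
  | all h => exact ⟨_, rfl⟩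
  | ex h => rw [hx] at h; cases h

theorem IsGirardLink.exists_eq_ex {x : Vertex Γ} {l : GLink V (Vertex Γ)}
    (hl : IsGirardLink θ ε x l) {B : Fml L (V ⊕ Addr k) 1} (hx : node Γ x.1 = some (.ex B)) :
    ∃ h, l = .ex h ∧ h.1 = (x.1.1, .body :: x.1.2) := by
  cases hl with
  | ax h => obtain ⟨_, _, _, h⟩ := h; rw [hx] at h; cases h
  | tensor h => rw [hx] at h; cases h
  | par h => rw [hx] at h; cases h
  | all h => rw [hx] at h; cases h
  | ex h h1 => exact ⟨_, rfl, h1⟩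

theorem node_root (Γ : Sequent L V k) (i : Fin k) :
    node Γ (i, []) = some ((Γ i).rename Sum.inl) :=
  rfl

theorem girardLabel_root (σ : Assignment Γ) (ε : Addr k → V) (i : Fin k) :
    girardLabel σ ε (Vertex.mk (node_root Γ i)) = Γ i := by
  rw [girardLabel_eq σ ε (node_root Γ i), Fml.rename, Fml.subst_subst]
  conv_rhs => rw [← Fml.subst_var (Γ i)]
  congr 1
  funext z
  obtain a | i := z
  · rfl
  · exact i.elim0

/-- The Girard proof structure of a unification net `θ`, with witnesses given by the unifier `σ` and
eigenvariables `ε`. -/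
noncomputable def girardStructure (hθ : IsLinking D Γ θ) (hσ : IsUnifier D Γ θ σ)
    (hG : (netGraph Γ θ σ).Correct) (hε : IsFresh σ ε) {link : Vertex Γ → GLink V (Vertex Γ)}
    (hlink : ∀ x, IsGirardLink θ ε x (link x)) : GirardStructure D Γ where
  Occ := Vertex Γ
  finite_occ := inferInstance
  label := girardLabel σ ε
  link := link
  link_ok := IsGirardLink.linkOK hθ hσ hG hε hlink
  hyp_unique x y d d' h hx hy := by
    have := ((hlink x).eq_of_hyp hx).symm.trans ((hlink y).eq_of_hyp hy)
    simp only [Prod.mk.injEq, List.cons.injEq] at this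
    exact ⟨Subtype.ext (Prod.ext this.1 this.2.2), this.2.1⟩
  root i := Vertex.mk (node_root Γ i)
  root_injective i j h := congrArg (fun x : Vertex Γ => x.1.1) h
  label_root := girardLabel_root σ ε
  mem_root_iff := by
    rintro ⟨⟨i, p⟩, hx⟩
    constructor
    · rintro ⟨j, h⟩ y d hy
      have h1 := (hlink y).eq_of_hyp hy
      rw [← h] at h1
      cases congrArg Prod.snd h1
    · intro h
      cases p with
      | nil => exact ⟨i, rfl⟩
      | cons d p =>
        exact (h ⟨(i, p), isSome_node_of_cons hx⟩ d ((hlink _).hyp_eq rfl)).elim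
  eigen_unique x y a h h' hx hy := by
    have h1 := ((hlink x).of_eq_all hx).1
    have h2 := ((hlink y).of_eq_all hy).1
    exact Subtype.ext (hε.injective (h1.symm.trans h2))
  eigen_not_free x a h hx i := by
    rw [((hlink x).of_eq_all hx).1]
    exact hε.not_free _ i

variable {hθ : IsLinking D Γ θ} {hσ : IsUnifier D Γ θ σ} {hG : (netGraph Γ θ σ).Correct}
  {hε : IsFresh σ ε} {link : Vertex Γ → GLink V (Vertex Γ)}
  {hlink : ∀ x, IsGirardLink θ ε x (link x)}

/-- Roots and hypotheses determine tracking, so any address function compatible with both computes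
it. -/
theorem GirardStructure.Tracks.eq_of_forall {G : GirardStructure D Γ} {x : G.Occ} {q : Addr k}
    (hx : G.Tracks x q) (f : G.Occ → Addr k) (hroot : ∀ i, f (G.root i) = (i, []))
    (hhyp : ∀ x h d, (G.link x).hyp d = some h → f h = ((f x).1, d :: (f x).2)) : f x = q := by
  induction hx with
  | root i => exact hroot i
  | hyp _ h ih => rw [hhyp _ _ _ h, ih]

theorem tracks_girardStructure (x : Vertex Γ) (q : Addr k) :
    (girardStructure hθ hσ hG hε hlink).Tracks x q ↔ x.1 = q := by
  constructor
  · exact fun h => h.eq_of_forall Subtype.val (fun _ => rfl) fun x h d hd => (hlink x).eq_of_hyp hd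
  · rintro rfl
    obtain ⟨⟨i, p⟩, hx⟩ := x
    induction p with
    | nil => exact .root i
    | cons d p ih =>
      exact .hyp (x := (⟨(i, p), isSome_node_of_cons hx⟩ : Vertex Γ)) (ih _) ((hlink _).hyp_eq rfl)

theorem link_eq_ax_iff (hθ : IsLinking D Γ θ) (hlink : ∀ x, IsGirardLink θ ε x (link x))
    {x y : Vertex Γ} : link x = .ax y ↔ s(x, y) ∈ θ := by
  refine ⟨fun h => (hlink x).mem_of_eq_ax h, fun h => ?_⟩
  obtain ⟨z, hz⟩ := (hlink x).exists_eq_ax (hθ.isLeaf h)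
  rw [hz, (hθ.2 x (hθ.isLeaf h)).unique h ((hlink x).mem_of_eq_ax hz)]

/-- Undirected edges, switched vertices and edges into unswitched vertices agree with those of the
net graph. Leaps need not be jumps, since a witness is free in the hypothesis of its `∃`-link but
not necessarily in the conclusion; `Correct.of_transGen` allows edges into switched vertices to be
dropped. -/
theorem isNet_girardStructure : (girardStructure hθ hσ hG hε hlink).IsNet := by
  have hu : (girardStructure hθ hσ hG hε hlink).graph.undirected = θ := by
    ext e
    constructor
    · rintro ⟨x, y, rfl, h⟩
      exact (link_eq_ax_iff hθ hlink).1 h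
    · induction e with
      | h x y => exact fun h => ⟨x, y, rfl, (link_eq_ax_iff hθ hlink).2 h⟩
  have hs : (girardStructure hθ hσ hG hε hlink).graph.switched = (netGraph Γ θ σ).switched := by
    ext x
    refine or_congr ⟨?_, ?_⟩ ⟨?_, ?_⟩
    · rintro ⟨h, h', hx⟩
      exact (hlink x).of_eq_par hx
    · rintro ⟨A, B, hx⟩
      exact (hlink x).exists_eq_par hx
    · rintro ⟨a, h, hx⟩
      exact ((hlink x).of_eq_all hx).2
    · intro hx
      obtain ⟨h, hx⟩ := (hlink x).exists_eq_all hx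
      exact ⟨_, h, hx⟩
  have hd : ∀ x y, (girardStructure hθ hσ hG hε hlink).graph.directed x y →
      Relation.TransGen (netGraph Γ θ σ).directed x y := by
    rintro x y (⟨d, h⟩ | ⟨a, h, hy, hx⟩)
    · exact .single (.inl ⟨d, (hlink y).eq_of_hyp h⟩)
    · obtain ⟨rfl, hu⟩ := (hlink y).of_eq_all hy
      exact hε.transGen_of_free hu hx
  have hd' : ∀ x y, y ∉ (netGraph Γ θ σ).switched →
      ((girardStructure hθ hσ hG hε hlink).graph.directed x y ↔ (netGraph Γ θ σ).directed x y) := by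
    intro x y hy
    constructor
    · rintro (⟨d, h⟩ | ⟨a, h, hy', -⟩)
      · exact .inl ⟨d, (hlink y).eq_of_hyp h⟩
      · exact (hy (.inr ((hlink y).of_eq_all hy').2)).elim
    · rintro (⟨d, h⟩ | ⟨h, -⟩)
      · exact .inl ⟨d, (hlink y).hyp_eq h⟩
      · exact (hy (.inr h)).elim
  have hc := hG.of_transGen (fun x y _ => hd x y) hd'
  have he : (girardStructure hθ hσ hG hε hlink).graph =
      (netGraph Γ θ σ).withDirected (girardStructure hθ hσ hG hε hlink).graph.directed := by
    calc (girardStructure hθ hσ hG hε hlink).graph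
        = ⟨(girardStructure hθ hσ hG hε hlink).graph.undirected,
            (girardStructure hθ hσ hG hε hlink).graph.directed,
            (girardStructure hθ hσ hG hε hlink).graph.switched⟩ := rfl
      _ = _ := by rw [hu, hs]; rfl
  rw [GirardStructure.IsNet, he]
  exact hc

theorem translation_girardStructure : (girardStructure hθ hσ hG hε hlink).translation = θ := by
  ext e
  constructor
  · rintro ⟨x, y, l, l', rfl, h, hx, hy⟩
    obtain rfl : x = l := Subtype.ext ((tracks_girardStructure x _).1 hx)
    obtain rfl : y = l' := Subtype.ext ((tracks_girardStructure y _).1 hy)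
    exact (link_eq_ax_iff hθ hlink).1 h
  · induction e with
    | h x y =>
      exact fun h => ⟨x, y, x, y, rfl, (link_eq_ax_iff hθ hlink).2 h,
        (tracks_girardStructure x _).2 rfl, (tracks_girardStructure y _).2 rfl⟩

theorem witnessedBy_girardStructure : (girardStructure hθ hσ hG hε hlink).WitnessedBy σ := by
  refine ⟨ε, fun x a h q hx hq => ?_, fun x e hx => ?_⟩
  · rw [← (tracks_girardStructure x q).1 hq]
    exact ((hlink x).of_eq_all hx).1.symm
  · have hxe : x.1 = e.1 := (tracks_girardStructure x _).1 hx
    obtain ⟨B, hB, -⟩ := e.2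
    rw [← hxe] at hB
    obtain ⟨h, hxh, hh⟩ := (hlink x).exists_eq_ex hB
    refine ⟨_, h, girardLabel_eq σ ε hB, hxh, ?_⟩
    rw [← σ.read_of_isExistential ε e, ← hxe]
    exact girardLabel_body σ ε (.inr hB) hh

end Construction

end UNet

theorem mainTheorem8 {L : FirstOrder.Language.{u, v}} (D : UNet.Duality L)
    {V : Type w} [Infinite V] {k : ℕ} (Γ : UNet.Sequent L V k)
    (θ : Set (Sym2 (UNet.Vertex Γ))) (hθ : UNet.IsUnificationNet D Γ θ) :
    (∃ G : UNet.GirardStructure D Γ, G.IsNet ∧ G.translation = θ) ∧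
    (∀ σ : UNet.Assignment Γ, UNet.IsMGU D Γ θ σ →
      ∃ G : UNet.GirardStructure D Γ, G.IsNet ∧ G.translation = θ ∧ G.WitnessedBy σ) := by
  obtain ⟨hl, σ₀, hσ₀, hc⟩ := hθ
  have main : ∀ σ : UNet.Assignment Γ, UNet.IsMGU D Γ θ σ →
      ∃ G : UNet.GirardStructure D Γ, G.IsNet ∧ G.translation = θ ∧ G.WitnessedBy σ := by
    intro σ hσ
    obtain ⟨ε, hε⟩ := UNet.exists_isFresh σ
    choose link hlink using hl.exists_isGirardLink ε
    -- Correctness is given for `σ₀` and transferred to `σ`, as both have the same graph.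
    exact ⟨UNet.girardStructure hl hσ.1 (hσ₀.netGraph_eq hσ ▸ hc) hε hlink,
      UNet.isNet_girardStructure, UNet.translation_girardStructure,
      UNet.witnessedBy_girardStructure⟩
  obtain ⟨G, h, h', -⟩ := main σ₀ hσ₀
  exact ⟨⟨G, h, h'⟩, main⟩
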